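/- Let $k$ be a field of arbitrary characteristic and let $(V,\omega)$ be a symplectic vector space over $k$ of dimension $2n$, i.e. $\omega$ is an alternating non-degenerate bilinear form on $V$ and $\dim_k V=2n$. A basis $(e_1,\dots,e_n,f_1,\dots,f_n)$ of $V$ is called symplectic if $\omega(e_i,e_j)=\omega(f_i,f_j)=0$ and $\omega(e_i,f_j)=\delta_{ij}$ for all $i,j$. For $M\in\operatorname{End}(V)$ let $M^{*\omega}$ be the symplectic adjoint, determined by $\omega(Mv,w)=\omega(v,M^{*\omega}w)$ for all $v,w\in V$. Define the symplectic characteristic polynomial of $M$ by \[ \chi^{\omega}_M(s,t)=\operatorname{Pf}\bigl(\omega(v_i,Av_j)\bigr)_{1\le i,j\le 2n}\in k[s,t],\qquad A=(M-sE)(M^{*\omega}-sE)-tE, \] where $E$ is the identity, $\omega$, $M$, $M^{*\omega}$ are extended to $V\otimes_k k[s,t]$, and $(v_1,\dots,v_{2n})=(e_1,f_1,\dots,e_n,f_n)$ for a symplectic basis $(e_1,\dots,e_n,f_1,\dots,f_n)$ of $V$; the result does not depend on the choice of this basis. Let $M\in\operatorname{End}(V)$ be symplectically normal, i.e. $MM^{*\omega}=M^{*\omega}M$,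 and diagonalizable, i.e. $V$ has a basis of eigenvectors of $M$. Then $\chi^{\omega}_M$ is of the form \[ \chi^{\omega}_M(s,t)=\prod_{i=1}^n\{(\lambda_i-s)(\mu_i-s)-t\},\qquad \lambda_i,\mu_i\in k, \] and for every choice of $\lambda_1,\dots,\lambda_n,\mu_1,\dots,\mu_n\in k$ for which this equality holds, there is a symplectic basis $(e_1,\dots,e_n,f_1,\dots,f_n)$ of $V$ such that \[ Me_i=\lambda_i e_i,\qquad Mf_i=\mu_i f_i,\qquad i\in\{1,\dots,n\}. \] -/

import Mathlib

open Module
open scoped TensorProduct Polynomial Polynomial.Bivariate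

namespace SymplecticLA

section Pfaffian

variable {R : Type*} [CommRing R] {n : ℕ}

/-- Permutations of `{0, …, 2n-1}` with `σ(2i) < σ(2i+1)` for all `i` and
`σ(0) < σ(2) < ⋯ < σ(2n-2)`, i.e. the normal forms of the perfect matchings. Here
`finProdFinEquiv (i, j)` is the element `2 * i + j` of `Fin (n * 2)`. -/
def IsMatchingPerm (σ : Equiv.Perm (Fin (n * 2))) : Prop :=
  (∀ i : Fin n, σ (finProdFinEquiv (i, 0)) < σ (finProdFinEquiv (i, 1))) ∧
    StrictMono fun i : Fin n => σ (finProdFinEquiv (i, 0))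

open scoped Classical in
/-- The Pfaffian of an (alternating) matrix of order `2n` over a commutative ring:
`∑ sign(σ) ∏ᵢ A(σ(2i), σ(2i+1))`, the sum being over the perfect matchings. -/
noncomputable def pfaffian (A : Matrix (Fin (n * 2)) (Fin (n * 2)) R) : R :=
  ∑ σ : Equiv.Perm (Fin (n * 2)) with IsMatchingPerm σ,
    ((Equiv.Perm.sign σ : ℤ) : R) *
      ∏ i : Fin n, A (σ (finProdFinEquiv (i, 0))) (σ (finProdFinEquiv (i, 1)))

end Pfaffian

variable {k : Type*} [Field k] {V : Type*} [AddCommGroup V] [Module k V]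

/-- A symplectic form: an alternating non-degenerate bilinear form. -/
structure IsSymplectic (ω : LinearMap.BilinForm k V) : Prop where
  alt : ω.IsAlt
  nondegenerate : ω.Nondegenerate

/-- `(e₁, …, eₙ, f₁, …, fₙ)`, with `eᵢ = b (inl i)` and `fᵢ = b (inr i)`, is a symplectic basis. -/
structure IsSymplecticBasis {n : ℕ} (ω : LinearMap.BilinForm k V)
    (b : Basis (Fin n ⊕ Fin n) k V) : Prop where
  left_left : ∀ i j, ω (b (Sum.inl i)) (b (Sum.inl j)) = 0
  right_right : ∀ i j, ω (b (Sum.inr i)) (b (Sum.inr j)) = 0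
  left_right : ∀ i j, ω (b (Sum.inl i)) (b (Sum.inr j)) = if i = j then 1 else 0

/-- `M` is diagonalizable: there is a basis of eigenvectors. -/
def IsDiagonalizable (M : End k V) : Prop :=
  ∃ b : Basis (Fin (finrank k V)) k V, ∀ i, ∃ c : k, M (b i) = c • b i

section Existence

theorem exists_symplectic_vectors [FiniteDimensional k V]
    {ω : LinearMap.BilinForm k V} (hω : IsSymplectic ω) {n : ℕ} :
    ∀ (m : ℕ), m ≤ n → finrank k V = 2 * n → ∃ e f : Fin m → V,
      (∀ i j, ω (e i) (e j) = 0) ∧ (∀ i j, ω (f i) (f j) = 0) ∧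
      (∀ i j, ω (e i) (f j) = if i = j then 1 else 0) := by
  intro m
  induction m with
  | zero => exact fun _ _ => ⟨Fin.elim0, Fin.elim0, fun i => i.elim0, fun i => i.elim0,
      fun i => i.elim0⟩
  | succ m ih =>
    intro hm hd
    obtain ⟨e, f, hee, hff, hef⟩ := ih (by omega) hd
    have hsw : ∀ x y, ω x y = 0 → ω y x = 0 := fun x y h => hω.alt.isRefl x y h
    have hfe : ∀ i j, ω (f i) (e j) = if i = j then -1 else 0 := by
      intro i j
      rw [← hω.alt.neg_eq, hef]
      simp only [eq_comm (a := j)]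
      split_ifs <;> simp
    -- orthogonal correction of a vector with respect to the vectors found so far
    let P : V → V := fun v => v - ∑ i, (ω v (f i)) • e i + ∑ i, (ω v (e i)) • f i
    have hPe : ∀ v j, ω (P v) (e j) = 0 := by
      intro v j
      simp [P, hee, hfe]
    have hPf : ∀ v j, ω (P v) (f j) = 0 := by
      intro v j
      simp [P, hff, hef]
    -- some corrected vector is non-zero, for dimension reasons
    have hex : ∃ v, P v ≠ 0 := by
      by_contra! h
      have htop : Submodule.span k (Set.range (Sum.elim e f)) = ⊤ := by
        rw [eq_top_iff]
        intro v _
        have hv : v = ∑ i, (ω v (f i)) • e i - ∑ i, (ω v (e i)) • f i := by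
          have := h v
          simp only [P] at this
          rw [← sub_eq_zero, ← this]
          abel
        rw [hv]
        refine Submodule.sub_mem _ (Submodule.sum_mem _ fun i _ => ?_)
          (Submodule.sum_mem _ fun i _ => ?_)
        · exact Submodule.smul_mem _ _ (Submodule.subset_span ⟨Sum.inl i, rfl⟩)
        · exact Submodule.smul_mem _ _ (Submodule.subset_span ⟨Sum.inr i, rfl⟩)
      have h1 := finrank_range_le_card (R := k) (Sum.elim e f)
      rw [Set.finrank, htop, finrank_top, hd] at h1
      simp at h1
      omega
    obtain ⟨v, hv⟩ := hex
    obtain ⟨w, hw⟩ : ∃ w, ω (P v) w ≠ 0 := by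
      by_contra! h
      exact hv (hω.nondegenerate.1 _ h)
    set x := P v with hx
    have hxe : ∀ j, ω x (e j) = 0 := hPe v
    have hxf : ∀ j, ω x (f j) = 0 := hPf v
    set y := (ω x w)⁻¹ • P w with hy
    have hye : ∀ j, ω y (e j) = 0 := by intro j; simp [hy, hPe]
    have hyf : ∀ j, ω y (f j) = 0 := by intro j; simp [hy, hPf]
    have hxy : ω x y = 1 := by
      simp [hy, P, hxe, hxf, hw]
    refine ⟨Fin.cons x e, Fin.cons y f, ?_, ?_, ?_⟩
    · intro i j
      refine Fin.cases ?_ (fun i => ?_) i <;> refine Fin.cases ?_ (fun j => ?_) j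
      · simpa using hω.alt x
      · simpa using hxe j
      · simpa using hsw _ _ (hxe i)
      · simpa using hee i j
    · intro i j
      refine Fin.cases ?_ (fun i => ?_) i <;> refine Fin.cases ?_ (fun j => ?_) j
      · simpa using hω.alt y
      · simpa using hyf j
      · simpa using hsw _ _ (hyf i)
      · simpa using hff i j
    · intro i j
      refine Fin.cases ?_ (fun i => ?_) i <;> refine Fin.cases ?_ (fun j => ?_) j
      · simpa using hxy
      · simpa [(Fin.succ_ne_zero j).symm] using hxf j
      · simpa [Fin.succ_ne_zero] using hsw _ _ (hye i)
      · simpa using hef i j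

/-- Every symplectic vector space has a symplectic basis. -/
theorem exists_isSymplecticBasis [FiniteDimensional k V]
    {ω : LinearMap.BilinForm k V} (hω : IsSymplectic ω) {n : ℕ} (hn : finrank k V = 2 * n) :
    ∃ b : Basis (Fin n ⊕ Fin n) k V, IsSymplecticBasis ω b := by
  obtain ⟨e, f, hee, hff, hef⟩ := exists_symplectic_vectors hω n le_rfl hn
  have hli : LinearIndependent k (Sum.elim e f) := by
    rw [Fintype.linearIndependent_iff]
    intro g hg
    have h1 : ∑ i, g (Sum.inl i) • e i + ∑ i, g (Sum.inr i) • f i = 0 := by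
      simpa [Fintype.sum_sum_type] using hg
    rintro (j | j)
    · have := congrArg (fun z => ω z (f j)) h1
      simpa [hff, hef] using this
    · have := congrArg (fun z => ω (e j) z) h1
      simpa [hee, hef] using this
  let b := basisOfLinearIndependentOfCardEqFinrank' (Sum.elim e f) hli (by simp [hn]; omega)
  have hb : ⇑b = Sum.elim e f := coe_basisOfLinearIndependentOfCardEqFinrank' _ _ _
  exact ⟨b, by simpa [hb] using hee, by simpa [hb] using hff, by simpa [hb] using hef⟩

end Existence

variable [FiniteDimensional k V]

/-- The isomorphism `ω♭ : V → V*`, `v ↦ ω(·, v)`. -/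
noncomputable def flat {ω : LinearMap.BilinForm k V} (hω : IsSymplectic ω) :
    V ≃ₗ[k] Dual k V :=
  LinearMap.BilinForm.toDual (LinearMap.BilinForm.flip ω) hω.nondegenerate.flip

/-- The symplectic adjoint `M^{*ω} = (ω♭)⁻¹ ∘ M^* ∘ ω♭`. -/
noncomputable def sympAdjoint {ω : LinearMap.BilinForm k V} (hω : IsSymplectic ω)
    (M : End k V) : End k V :=
  (flat hω).symm.toLinearMap ∘ₗ M.dualMap ∘ₗ (flat hω).toLinearMap

/-- The defining property `ω(Mv, w) = ω(v, M^{*ω} w)`. -/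
theorem apply_sympAdjoint {ω : LinearMap.BilinForm k V} (hω : IsSymplectic ω)
    (M : End k V) (v w : V) : ω v (sympAdjoint hω M w) = ω (M v) w := by
  have h : flat hω (sympAdjoint hω M w) = M.dualMap (flat hω w) := by simp [sympAdjoint]
  exact congrArg (fun φ : Dual k V => φ v) h

/-- The family `(e₁, f₁, …, eₙ, fₙ)` attached to `(e₁, …, eₙ, f₁, …, fₙ)`. -/
def interleave {n : ℕ} (b : Fin n ⊕ Fin n → V) (i : Fin (n * 2)) : V :=
  ![b (Sum.inl (finProdFinEquiv.symm i).1), b (Sum.inr (finProdFinEquiv.symm i).1)]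
    (finProdFinEquiv.symm i).2

section Extension

variable (R : Type*) [CommRing R] [Algebra k R]

/-- The endomorphism `(M - s)(M^{*ω} - s) - t` of the scalar extension `V ⊗ R`, where `R` is a
commutative `k`-algebra and `s, t ∈ R`. -/
noncomputable def charEnd {ω : LinearMap.BilinForm k V} (hω : IsSymplectic ω) (M : End k V)
    (s t : R) : End R (R ⊗[k] V) :=
  (M.baseChange R - s • LinearMap.id) ∘ₗ ((sympAdjoint hω M).baseChange R - s • LinearMap.id) -
    t • LinearMap.id

/-- The matrix `(ω(vᵢ, A vⱼ))ᵢⱼ` of `ω_A` for `A = (M - s)(M^{*ω} - s) - t`, where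
`(v₁, …, v₂ₙ) = (e₁, f₁, …, eₙ, fₙ)` and `ω` is extended to `V ⊗ R`. -/
noncomputable def charMatrix {ω : LinearMap.BilinForm k V} (hω : IsSymplectic ω) {n : ℕ}
    (b : Basis (Fin n ⊕ Fin n) k V) (M : End k V) (s t : R) :
    Matrix (Fin (n * 2)) (Fin (n * 2)) R :=
  Matrix.of fun i j => LinearMap.BilinForm.baseChange R ω
    (1 ⊗ₜ[k] interleave b i) (charEnd R hω M s t (1 ⊗ₜ[k] interleave b j))

end Extension

/-- The symplectic characteristic polynomial of `M`: the Pfaffian of `ω_A` over `R = k[s,t]`,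
`A = (M - s)(M^{*ω} - s) - t`, with respect to a symplectic basis. The Pfaffian does not depend
on the symplectic basis, because symplectic automorphisms have determinant one.
The ring `k[s,t]` is `k[X][Y]`, with `s = C X` (inner variable) and `t = X` (outer variable). -/
noncomputable def sympCharPoly {ω : LinearMap.BilinForm k V} (hω : IsSymplectic ω) {n : ℕ}
    (hn : finrank k V = 2 * n) (M : End k V) : k[X][Y] :=
  pfaffian (charMatrix k[X][Y] hω (exists_isSymplecticBasis hω hn).choose M
    (Polynomial.C Polynomial.X) Polynomial.X)

end SymplecticLA

open SymplecticLA

/-!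
# Symplectically normal diagonalizable endomorphisms

The adjoint `M^*` of a diagonalizable `M` is diagonalizable, through the dual of an eigenbasis. If
`M` and `M^*` commute, `V` is therefore spanned by common eigenvectors. Let `V(c, d)` be the space
of `v` with `M v = c v` and `M^* v = d v`. From `ω(Mv, w) = ω(v, M^* w)` and
`ω(M^* v, w) = ω(v, Mw)`, the space `V(c, d)` is orthogonal to every `V(c', d')` except `V(d, c)`.
So hyperbolic pairs can be split off one at a time among common eigenvectors, which yields a
symplectic basis with `M eᵢ = λᵢ eᵢ`, `M^* eᵢ = μᵢ eᵢ`, `M fᵢ = μᵢ fᵢ`, `M^* fᵢ = λᵢ fᵢ`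
(`exists_symplectic_eigenvectors`).

In this basis the matrix of `ω_A`, for `A = (M - s)(M^* - s) - t`, is block diagonal with blocks of
order two, and its Pfaffian is `∏ ((λᵢ - s)(μᵢ - s) - t)` (`pfaffian_of_blockDiagonal`). The
Pfaffian does not depend on the symplectic basis
(`pfaffianAlternating_eq_of_isSymplecticBasis`). Indeed the Pfaffian of a Gram matrix `B(vᵢ, vⱼ)`
is an alternating multilinear function of the `vᵢ`, so a base change multiplies it by the
determinant; taking `B = ω` shows that the determinant between symplectic bases is one. That the
function vanishes on families with two equal vectors (`pfaffian_eq_zero_of_swap`) is a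
cancellation of terms in pairs. It holds in every characteristic, as the terms without a partner
are themselves zero.

Finally, let the characteristic polynomial be written with any `λᵢ, μᵢ`. As a polynomial in `t` it
has the roots `(λᵢ - s)(μᵢ - s)` in `k[s]`, and each of these determines the unordered pair
`{λᵢ, μᵢ}`. So the given eigenvalues are those of the basis above up to a permutation of the pairs
and an exchange within some of them, and the basis is adapted by permuting and by replacing `(e, f)`
by `(f, -e)`.
-/

namespace SymplecticLA

/-! ### Perfect matchings and their normal forms -/

section Matching

variable {n : ℕ}

/-- The fixed-point-free involution of `Fin (n * 2)` exchanging `2 * i` and `2 * i + 1`. -/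
def partner (n : ℕ) : Equiv.Perm (Fin (n * 2)) :=
  finProdFinEquiv.permCongr (Equiv.prodCongrRight fun _ => Equiv.swap 0 1)

/-- The perfect matching determined by `σ`, encoded as the fixed-point-free involution which
exchanges `σ (2 * i)` and `σ (2 * i + 1)`. -/
def matching (σ : Equiv.Perm (Fin (n * 2))) : Equiv.Perm (Fin (n * 2)) :=
  σ * partner n * σ⁻¹

/-- The permutation of `Fin (n * 2)` which acts on the block `{2 * i, 2 * i + 1}` by `ε i`. -/
def flipBlocks (ε : Fin n → Equiv.Perm (Fin 2)) : Equiv.Perm (Fin (n * 2)) :=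
  finProdFinEquiv.permCongr (Equiv.prodCongrRight ε)

/-- The permutation of `Fin (n * 2)` which permutes the blocks `{2 * i, 2 * i + 1}` by `π`. -/
def shuffleBlocks (π : Equiv.Perm (Fin n)) : Equiv.Perm (Fin (n * 2)) :=
  finProdFinEquiv.permCongr (Equiv.prodCongrLeft fun _ : Fin 2 => π)

@[simp]
theorem partner_apply (i : Fin n) (c : Fin 2) :
    partner n (finProdFinEquiv (i, c)) = finProdFinEquiv (i, Equiv.swap 0 1 c) := by
  simp [partner, Equiv.permCongr_apply]

@[simp]
theorem flipBlocks_apply (ε : Fin n → Equiv.Perm (Fin 2)) (i : Fin n) (c : Fin 2) :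
    flipBlocks ε (finProdFinEquiv (i, c)) = finProdFinEquiv (i, ε i c) := by
  simp [flipBlocks, Equiv.permCongr_apply]

@[simp]
theorem shuffleBlocks_apply (π : Equiv.Perm (Fin n)) (i : Fin n) (c : Fin 2) :
    shuffleBlocks π (finProdFinEquiv (i, c)) = finProdFinEquiv (π i, c) := by
  simp [shuffleBlocks, Equiv.permCongr_apply]

theorem sign_flipBlocks (ε : Fin n → Equiv.Perm (Fin 2)) :
    Equiv.Perm.sign (flipBlocks ε) = ∏ i, Equiv.Perm.sign (ε i) := by
  simp [flipBlocks, Equiv.Perm.sign_permCongr, Equiv.Perm.sign_prodCongrRight]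

theorem sign_shuffleBlocks (π : Equiv.Perm (Fin n)) :
    Equiv.Perm.sign (shuffleBlocks π) = 1 := by
  simp [shuffleBlocks, Equiv.Perm.sign_permCongr, Equiv.Perm.sign_prodCongrLeft]

theorem partner_ne (x : Fin (n * 2)) : partner n x ≠ x := by
  obtain ⟨⟨i, c⟩, rfl⟩ := finProdFinEquiv.surjective x
  fin_cases c <;> simp

theorem eq_one_or_eq_swap (e : Equiv.Perm (Fin 2)) : e = 1 ∨ e = Equiv.swap 0 1 := by
  revert e
  decide

theorem flipBlocks_mul_partner (ε : Fin n → Equiv.Perm (Fin 2)) :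
    flipBlocks ε * partner n = partner n * flipBlocks ε := by
  ext x
  obtain ⟨⟨i, c⟩, rfl⟩ := finProdFinEquiv.surjective x
  rcases eq_one_or_eq_swap (ε i) with h | h <;> simp [h]

theorem shuffleBlocks_mul_partner (π : Equiv.Perm (Fin n)) :
    shuffleBlocks π * partner n = partner n * shuffleBlocks π := by
  ext x
  obtain ⟨⟨i, c⟩, rfl⟩ := finProdFinEquiv.surjective x
  simp

theorem matching_mul_of_commute (σ : Equiv.Perm (Fin (n * 2))) {h : Equiv.Perm (Fin (n * 2))}
    (hh : h * partner n = partner n * h) : matching (σ * h) = matching σ := by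
  rw [matching, matching, mul_assoc σ h, hh, mul_inv_rev]
  group

theorem matching_mul_left (τ σ : Equiv.Perm (Fin (n * 2))) :
    matching (τ * σ) = τ * matching σ * τ⁻¹ := by
  rw [matching, matching]
  group

@[simp]
theorem matching_apply (σ : Equiv.Perm (Fin (n * 2))) (x : Fin (n * 2)) :
    matching σ (σ x) = σ (partner n x) := by
  simp [matching]

theorem matching_ne (σ : Equiv.Perm (Fin (n * 2))) (x : Fin (n * 2)) : matching σ x ≠ x := by
  obtain ⟨y, rfl⟩ := σ.surjective x
  simpa using partner_ne y

theorem IsMatchingPerm.range_eq {σ : Equiv.Perm (Fin (n * 2))} (hσ : IsMatchingPerm σ) :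
    Set.range (fun i : Fin n => σ (finProdFinEquiv (i, 0))) = {x | x < matching σ x} := by
  ext x
  simp only [Set.mem_range, Set.mem_ofPred_eq]
  constructor
  · rintro ⟨i, rfl⟩
    simpa using hσ.1 i
  · intro hx
    obtain ⟨y, rfl⟩ := σ.surjective x
    obtain ⟨⟨i, c⟩, rfl⟩ := finProdFinEquiv.surjective y
    fin_cases c
    · exact ⟨i, rfl⟩
    · exact absurd hx (by simpa using (hσ.1 i).le)

/-- A normal form is determined by its matching: the first elements of its pairs are the points
below their partners, in increasing order. -/
theorem IsMatchingPerm.ext {σ σ' : Equiv.Perm (Fin (n * 2))} (hσ : IsMatchingPerm σ)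
    (hσ' : IsMatchingPerm σ') (h : matching σ = matching σ') : σ = σ' := by
  have h0 : (fun i : Fin n => σ (finProdFinEquiv (i, 0))) =
      fun i : Fin n => σ' (finProdFinEquiv (i, 0)) :=
    (StrictMono.range_inj hσ.2 hσ'.2).1 (by rw [hσ.range_eq, hσ'.range_eq, h])
  have h0' : ∀ i, σ (finProdFinEquiv (i, 0)) = σ' (finProdFinEquiv (i, 0)) := congrFun h0
  refine Equiv.ext fun x => ?_
  obtain ⟨⟨i, c⟩, rfl⟩ := finProdFinEquiv.surjective x
  fin_cases c
  · exact h0' i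
  · have h1 := congrArg (matching σ) (h0' i)
    rw [matching_apply] at h1
    rw [h, matching_apply] at h1
    simpa using h1

/-- Every permutation is brought to normal form by ordering its pairs, then sorting them. -/
theorem exists_isMatchingPerm (σ : Equiv.Perm (Fin (n * 2))) :
    ∃ ε π, IsMatchingPerm (σ * flipBlocks ε * shuffleBlocks π) := by
  let ε : Fin n → Equiv.Perm (Fin 2) := fun i =>
    if σ (finProdFinEquiv (i, 0)) < σ (finProdFinEquiv (i, 1)) then 1 else Equiv.swap 0 1
  let g : Fin n → Fin (n * 2) := fun i => (σ * flipBlocks ε) (finProdFinEquiv (i, 0))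
  have hg : Function.Injective g := by
    intro i j hij
    have := (finProdFinEquiv.injective ((σ * flipBlocks ε).injective hij))
    exact congrArg Prod.fst this
  refine ⟨ε, Tuple.sort g, fun i => ?_, ?_⟩
  · simp only [Equiv.Perm.mul_apply, shuffleBlocks_apply, flipBlocks_apply, ε]
    split_ifs with h
    · simpa using h
    · have hne : σ (finProdFinEquiv (Tuple.sort g i, 0)) ≠
          σ (finProdFinEquiv (Tuple.sort g i, 1)) := by simp
      simpa using lt_of_le_of_ne (not_lt.1 h) hne.symm
  · have h := (Tuple.monotone_sort g).strictMono_of_injective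
      (hg.comp (Tuple.sort g).injective)
    intro i j hij
    simpa only [Function.comp_apply, g, Equiv.Perm.mul_apply, shuffleBlocks_apply] using h hij

theorem isMatchingPerm_one : IsMatchingPerm (1 : Equiv.Perm (Fin (n * 2))) := by
  refine ⟨fun i => ?_, fun i j hij => ?_⟩
  · rw [Fin.lt_def, Equiv.Perm.one_apply, Equiv.Perm.one_apply, finProdFinEquiv_apply_val,
      finProdFinEquiv_apply_val]
    simp
  · simp only [Fin.lt_def, Equiv.Perm.one_apply, finProdFinEquiv_apply_val]
    simpa using hij

end Matching

/-! ### The Pfaffian as an alternating map -/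

section PfaffianTheory

variable {n : ℕ} {R : Type*} [CommRing R]

/-- The summand of the Pfaffian belonging to `σ`, for `σ` not necessarily in normal form. -/
def pfaffianTerm (A : Matrix (Fin (n * 2)) (Fin (n * 2)) R) (σ : Equiv.Perm (Fin (n * 2))) : R :=
  ((Equiv.Perm.sign σ : ℤ) : R) *
    ∏ i : Fin n, A (σ (finProdFinEquiv (i, 0))) (σ (finProdFinEquiv (i, 1)))

variable {A : Matrix (Fin (n * 2)) (Fin (n * 2)) R}

theorem pfaffianTerm_mul_flipBlocks (hA : ∀ x y, A y x = -A x y) (σ : Equiv.Perm (Fin (n * 2)))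
    (ε : Fin n → Equiv.Perm (Fin 2)) : pfaffianTerm A (σ * flipBlocks ε) = pfaffianTerm A σ := by
  simp only [pfaffianTerm, Equiv.Perm.sign_mul, sign_flipBlocks, Equiv.Perm.mul_apply,
    flipBlocks_apply]
  push_cast
  rw [mul_assoc, ← Finset.prod_mul_distrib]
  congr 1
  refine Finset.prod_congr rfl fun i _ => ?_
  rcases eq_one_or_eq_swap (ε i) with h | h
  · simp [h]
  · simp [h, hA (σ (finProdFinEquiv (i, 0)))]

theorem pfaffianTerm_mul_shuffleBlocks (σ : Equiv.Perm (Fin (n * 2))) (π : Equiv.Perm (Fin n)) :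
    pfaffianTerm A (σ * shuffleBlocks π) = pfaffianTerm A σ := by
  simp only [pfaffianTerm, Equiv.Perm.sign_mul, sign_shuffleBlocks, Equiv.Perm.mul_apply,
    shuffleBlocks_apply, mul_one]
  congr 1
  exact Equiv.prod_comp π fun i => A (σ (finProdFinEquiv (i, 0))) (σ (finProdFinEquiv (i, 1)))

/-- Every permutation has a normal form with the same matching and the same Pfaffian term. -/
theorem exists_normalForm (σ : Equiv.Perm (Fin (n * 2))) (hA : ∀ x y, A y x = -A x y) :
    ∃ σ', IsMatchingPerm σ' ∧ matching σ' = matching σ ∧ pfaffianTerm A σ' = pfaffianTerm A σ := by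
  obtain ⟨ε, π, h⟩ := exists_isMatchingPerm σ
  refine ⟨_, h, ?_, ?_⟩
  · rw [matching_mul_of_commute _ (shuffleBlocks_mul_partner π),
      matching_mul_of_commute _ (flipBlocks_mul_partner ε)]
  · rw [pfaffianTerm_mul_shuffleBlocks, pfaffianTerm_mul_flipBlocks hA]

open scoped Classical in
theorem pfaffian_eq_sum (A : Matrix (Fin (n * 2)) (Fin (n * 2)) R) :
    pfaffian A = ∑ σ : Equiv.Perm (Fin (n * 2)) with IsMatchingPerm σ, pfaffianTerm A σ := rfl

/-- The term of `σ` is zero if an entry between two matched indices does. -/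
theorem pfaffianTerm_eq_zero (hA : ∀ x y, A y x = -A x y) {σ : Equiv.Perm (Fin (n * 2))}
    {x : Fin (n * 2)} (h : A x (matching σ x) = 0) : pfaffianTerm A σ = 0 := by
  obtain ⟨y, rfl⟩ := σ.surjective x
  obtain ⟨⟨i, c⟩, rfl⟩ := finProdFinEquiv.surjective y
  rw [pfaffianTerm, Finset.prod_eq_zero (Finset.mem_univ i), mul_zero]
  fin_cases c
  · simpa using h
  · rw [hA, neg_eq_zero]
    simpa using h

/-- The Pfaffian of an alternating matrix with two equal rows and columns is zero: exchanging the
two indices is a sign-reversing involution on the non-vanishing terms. -/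
theorem pfaffian_eq_zero_of_swap (hA : ∀ x y, A y x = -A x y) {p q : Fin (n * 2)} (hpq : p ≠ q)
    (h0 : A p q = 0) (hswap : ∀ x y, A (Equiv.swap p q x) (Equiv.swap p q y) = A x y) :
    pfaffian A = 0 := by
  classical
  choose N hN hNm hNt using fun σ : Equiv.Perm (Fin (n * 2)) => exists_normalForm σ hA
  have hterm : ∀ σ, pfaffianTerm A (Equiv.swap p q * σ) = -pfaffianTerm A σ := by
    intro σ
    simp [pfaffianTerm, Equiv.Perm.sign_mul, Equiv.Perm.sign_swap hpq, hswap]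
  rw [pfaffian_eq_sum]
  refine Finset.sum_involution (fun σ _ => N (Equiv.swap p q * σ)) ?_ ?_ ?_ ?_
  · intro σ _
    rw [hNt, hterm, add_neg_cancel]
  · -- a matching fixed by the exchange of `p` and `q` contains the pair `{p, q}`
    intro σ _ hne hfix
    have hm : Equiv.swap p q * matching σ = matching σ * Equiv.swap p q := by
      have h1 := hNm (Equiv.swap p q * σ)
      rw [hfix, matching_mul_left] at h1
      nth_rewrite 2 [h1]
      group
    have h2 := congrArg (fun τ : Equiv.Perm (Fin (n * 2)) => τ p) hm
    simp only [Equiv.Perm.mul_apply, Equiv.swap_apply_left] at h2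
    by_cases hq : matching σ p = q
    · exact hne (pfaffianTerm_eq_zero hA (x := p) (by rw [hq, h0]))
    · rw [Equiv.swap_apply_of_ne_of_ne (matching_ne σ p) hq] at h2
      exact hpq ((matching σ).injective h2)
  · intro σ _
    simpa using hN _
  · intro σ hσ
    refine IsMatchingPerm.ext (hN _) (by simpa using hσ) ?_
    rw [hNm, matching_mul_left, hNm, matching_mul_left]
    simp [mul_assoc]

/-- The Pfaffian of a block diagonal alternating matrix with blocks of order two. -/
theorem pfaffian_of_blockDiagonal (hA : ∀ x y, A y x = -A x y)
    (hblock : ∀ x y, y ≠ partner n x → A x y = 0) :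
    pfaffian A = ∏ i : Fin n, A (finProdFinEquiv (i, 0)) (finProdFinEquiv (i, 1)) := by
  classical
  rw [pfaffian_eq_sum, Finset.sum_eq_single 1]
  · simp [pfaffianTerm]
  · intro σ hσ hne
    by_contra h
    refine hne (IsMatchingPerm.ext (by simpa using hσ) isMatchingPerm_one (Equiv.ext fun x => ?_))
    by_contra hx
    exact h (pfaffianTerm_eq_zero hA (hblock x _ (by simpa [matching] using hx)))
  · intro h
    exact absurd isMatchingPerm_one (by simpa using h)

variable {k V : Type*} [Field k] [AddCommGroup V] [Module k V] [Algebra k R]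

/-- A Pfaffian term of a Gram matrix is linear in each vector, since each index occurs in exactly
one factor. -/
theorem exists_pfaffianTerm_update (B : V →ₗ[k] V →ₗ[k] R)
    (σ : Equiv.Perm (Fin (n * 2))) (v : Fin (n * 2) → V)
    (p : Fin (n * 2)) :
    ∃ φ : V →ₗ[k] R, ∀ x,
      pfaffianTerm (Matrix.of fun i j => B (Function.update v p x i) (Function.update v p x j)) σ =
        φ x := by
  obtain ⟨y, rfl⟩ := σ.surjective p
  obtain ⟨⟨i, c⟩, rfl⟩ := finProdFinEquiv.surjective y
  -- only the factor of the block `i` involves the varying vector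
  have hprod : ∀ x, (∏ j ∈ Finset.univ.erase i,
      B (Function.update v (σ (finProdFinEquiv (i, c))) x (σ (finProdFinEquiv (j, 0))))
        (Function.update v (σ (finProdFinEquiv (i, c))) x (σ (finProdFinEquiv (j, 1))))) =
      ∏ j ∈ Finset.univ.erase i,
        B (v (σ (finProdFinEquiv (j, 0)))) (v (σ (finProdFinEquiv (j, 1)))) := by
    intro x
    refine Finset.prod_congr rfl fun j hj => ?_
    have hji : j ≠ i := Finset.ne_of_mem_erase hj
    rw [Function.update_of_ne (by simp [hji]), Function.update_of_ne (by simp [hji])]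
  let r : R := ((Equiv.Perm.sign σ : ℤ) : R) * ∏ j ∈ Finset.univ.erase i,
        B (v (σ (finProdFinEquiv (j, 0)))) (v (σ (finProdFinEquiv (j, 1))))
  let ψ : V →ₗ[k] R := if c = 0 then B.flip (v (σ (finProdFinEquiv (i, 1))))
    else B (v (σ (finProdFinEquiv (i, 0))))
  refine ⟨LinearMap.mulLeft k r ∘ₗ ψ, fun x => ?_⟩
  have hψ : B (Function.update v (σ (finProdFinEquiv (i, c))) x (σ (finProdFinEquiv (i, 0))))
      (Function.update v (σ (finProdFinEquiv (i, c))) x (σ (finProdFinEquiv (i, 1)))) = ψ x := by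
    fin_cases c <;> simp [ψ]
  simp only [pfaffianTerm, Matrix.of_apply]
  rw [← Finset.mul_prod_erase _ _ (Finset.mem_univ i), hprod, hψ, LinearMap.comp_apply,
    LinearMap.mulLeft_apply, mul_comm (ψ x), ← mul_assoc]

/-- The Pfaffian of the Gram matrix `(B(vᵢ, vⱼ))` of an alternating form `B`, as a function of
the vectors `v`. -/
noncomputable def pfaffianAlternating (n : ℕ) (B : V →ₗ[k] V →ₗ[k] R) (hB : B.IsAlt) :
    V [⋀^Fin (n * 2)]→ₗ[k] R where
  toFun v := pfaffian (Matrix.of fun i j => B (v i) (v j))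
  map_update_add' := by
    intro inst v p x y
    -- the signs in `pfaffianTerm` use the canonical decidable equality
    obtain rfl : inst = instDecidableEqFin _ := Subsingleton.elim _ _
    simp only [pfaffian_eq_sum]
    rw [← Finset.sum_add_distrib]
    refine Finset.sum_congr rfl fun σ _ => ?_
    obtain ⟨φ, hφ⟩ := exists_pfaffianTerm_update B σ v p
    simp only [hφ, map_add]
  map_update_smul' := by
    intro inst v p c x
    obtain rfl : inst = instDecidableEqFin _ := Subsingleton.elim _ _
    simp only [pfaffian_eq_sum]
    rw [Finset.smul_sum]
    refine Finset.sum_congr rfl fun σ _ => ?_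
    obtain ⟨φ, hφ⟩ := exists_pfaffianTerm_update B σ v p
    simp only [hφ, map_smul]
  map_eq_zero_of_eq' v p q hv hpq := by
    have hs : ∀ x, v (Equiv.swap p q x) = v x := by
      intro x
      rw [Equiv.swap_apply_def]
      split_ifs with hp hq
      · rw [hp, hv]
      · rw [hq, hv]
      · rfl
    refine pfaffian_eq_zero_of_swap (fun x y => ?_) hpq ?_ fun x y => ?_
    · simpa using (hB.neg (v x) (v y)).symm
    · simp [hv, hB.self_eq_zero]
    · simp [hs]

/-- An alternating map in top degree is determined by its value on a basis. -/
theorem alternatingMap_eq_det_smul {ι : Type*} [Fintype ι] [DecidableEq ι]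
    (f : V [⋀^ι]→ₗ[k] R) (b : Basis ι k V) (v : ι → V) : f v = b.det v • f b := by
  have h : f = (LinearMap.toSpanSingleton k R (f b)).compAlternatingMap b.det := by
    refine Basis.ext_alternating b fun i hi => ?_
    let σ : Equiv.Perm ι := Equiv.ofBijective i (Finite.injective_iff_bijective.1 hi)
    change f (b ∘ σ) = (LinearMap.toSpanSingleton k R (f b)).compAlternatingMap b.det (b ∘ σ)
    rw [AlternatingMap.map_perm, AlternatingMap.map_perm]
    simp [Basis.det_self]
  rw [h]
  simp [Basis.det_self]

end PfaffianTheory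

/-! ### The Pfaffian in a symplectic eigenbasis -/

section CharForm

variable {k V : Type*} [Field k] [AddCommGroup V] [Module k V] {n : ℕ}

/-- The indices of `(e₁, …, eₙ, f₁, …, fₙ)` reordered as in `(e₁, f₁, …, eₙ, fₙ)`. -/
def interleaveEquiv (n : ℕ) : Fin n ⊕ Fin n ≃ Fin (n * 2) :=
  (Equiv.boolProdEquivSum (Fin n)).symm.trans <| (Equiv.prodComm _ _).trans <|
    (Equiv.prodCongr (Equiv.refl _) finTwoEquiv.symm).trans finProdFinEquiv

@[simp]
theorem interleave_zero {W : Type*} (b : Fin n ⊕ Fin n → W) (i : Fin n) :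
    interleave b (finProdFinEquiv (i, 0)) = b (Sum.inl i) := by
  simp [interleave]

@[simp]
theorem interleave_one {W : Type*} (b : Fin n ⊕ Fin n → W) (i : Fin n) :
    interleave b (finProdFinEquiv (i, 1)) = b (Sum.inr i) := by
  simp [interleave]

theorem coe_reindex_interleaveEquiv (b : Basis (Fin n ⊕ Fin n) k V) :
    ⇑(b.reindex (interleaveEquiv n)) = interleave b := by
  funext x
  rw [Basis.reindex_apply]
  obtain ⟨y, rfl⟩ := (interleaveEquiv n).surjective x
  rw [Equiv.symm_apply_apply]
  rcases y with i | i
  · exact (interleave_zero b i).symm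
  · exact (interleave_one b i).symm

theorem IsSymplecticBasis.right_left {ω : LinearMap.BilinForm k V} (hω : IsSymplectic ω)
    {b : Basis (Fin n ⊕ Fin n) k V} (hb : IsSymplecticBasis ω b) (i j : Fin n) :
    ω (b (Sum.inr i)) (b (Sum.inl j)) = if i = j then -1 else 0 := by
  rw [← hω.alt.neg_eq, hb.left_right]
  simp only [eq_comm (a := j)]
  split_ifs <;> simp

variable {R : Type*} [CommRing R] [Algebra k R]

/-- If `b` is a symplectic basis, and `B` is an alternating form with `B x y = a i * ω x y` for
`y = eᵢ, fᵢ`, then the Pfaffian of the Gram matrix of `B` in `b` is the product of the `a i`. -/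
theorem pfaffian_gram_of_eigen {ω : LinearMap.BilinForm k V} (hω : IsSymplectic ω)
    {b : Basis (Fin n ⊕ Fin n) k V} (hb : IsSymplecticBasis ω b) {B : V →ₗ[k] V →ₗ[k] R}
    (hB : B.IsAlt) (a : Fin n → R)
    (hl : ∀ x i, B x (b (Sum.inl i)) = a i * algebraMap k R (ω x (b (Sum.inl i))))
    (hr : ∀ x i, B x (b (Sum.inr i)) = a i * algebraMap k R (ω x (b (Sum.inr i)))) :
    pfaffianAlternating n B hB (interleave b) = ∏ i, a i := by
  change pfaffian _ = _
  rw [pfaffian_of_blockDiagonal]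
  · refine Finset.prod_congr rfl fun i _ => ?_
    simp [hr, hb.left_right]
  · intro x y
    exact (hB.neg _ _).symm
  · intro x y hxy
    obtain ⟨⟨i, c⟩, rfl⟩ := finProdFinEquiv.surjective x
    obtain ⟨⟨j, d⟩, rfl⟩ := finProdFinEquiv.surjective y
    fin_cases c <;> fin_cases d
    · simp [hl, hb.left_left]
    · have : i ≠ j := by rintro rfl; simp at hxy
      simp [hr, hb.left_right, this]
    · have : i ≠ j := by rintro rfl; simp at hxy
      simp [hl, hb.right_left hω, this]
    · simp [hr, hb.right_right]

/-- The Pfaffian of a Gram matrix is the same in all symplectic bases, since the base change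
between them preserves the Pfaffian of `ω`, and so has determinant one. -/
theorem pfaffianAlternating_eq_of_isSymplecticBasis {ω : LinearMap.BilinForm k V}
    (hω : IsSymplectic ω) {b b' : Basis (Fin n ⊕ Fin n) k V} (hb : IsSymplecticBasis ω b)
    (hb' : IsSymplecticBasis ω b') {B : V →ₗ[k] V →ₗ[k] R} (hB : B.IsAlt) :
    pfaffianAlternating n B hB (interleave b') = pfaffianAlternating n B hB (interleave b) := by
  have h := alternatingMap_eq_det_smul (pfaffianAlternating n B hB)
    (b.reindex (interleaveEquiv n)) (interleave b')
  have h1 := alternatingMap_eq_det_smul (pfaffianAlternating n ω hω.alt)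
    (b.reindex (interleaveEquiv n)) (interleave b')
  rw [coe_reindex_interleaveEquiv] at h h1
  rw [pfaffian_gram_of_eigen hω hb hω.alt (fun _ => 1) (by simp) (by simp),
    pfaffian_gram_of_eigen hω hb' hω.alt (fun _ => 1) (by simp) (by simp)] at h1
  rw [h, show (b.reindex (interleaveEquiv n)).det (interleave b') = 1 by simpa using h1.symm,
    one_smul]

variable [FiniteDimensional k V]

theorem sympAdjoint_apply_left {ω : LinearMap.BilinForm k V} (hω : IsSymplectic ω) (M : End k V)
    (v w : V) : ω (sympAdjoint hω M v) w = ω v (M w) := by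
  rw [← hω.alt.neg_eq, apply_sympAdjoint, hω.alt.neg_eq]

/-- The form `(x, y) ↦ ω(x, A y)` on `V`, with values in `R`, for
`A = (M - s)(M^{*ω} - s) - t` over `R`. -/
noncomputable def charForm {ω : LinearMap.BilinForm k V} (hω : IsSymplectic ω) (M : End k V)
    (s t : R) : V →ₗ[k] V →ₗ[k] R :=
  LinearMap.mk₂ k (fun x y => algebraMap k R (ω x (M (sympAdjoint hω M y))) -
      s * algebraMap k R (ω x (M y) + ω x (sympAdjoint hω M y)) +
      (s * s - t) * algebraMap k R (ω x y))
    (by intro x x' y; simp; ring) (by intro c x y; simp [Algebra.smul_def]; ring)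
    (by intro x y y'; simp; ring) (by intro c x y; simp [Algebra.smul_def]; ring)

theorem charForm_apply {ω : LinearMap.BilinForm k V} (hω : IsSymplectic ω) (M : End k V)
    (s t : R) (x y : V) : charForm hω M s t x y =
      algebraMap k R (ω x (M (sympAdjoint hω M y))) -
      s * algebraMap k R (ω x (M y) + ω x (sympAdjoint hω M y)) +
      (s * s - t) * algebraMap k R (ω x y) := rfl

theorem charForm_isAlt {ω : LinearMap.BilinForm k V} (hω : IsSymplectic ω) (M : End k V)
    (s t : R) : (charForm hω M s t).IsAlt := by
  intro x
  have h1 : ω x (M (sympAdjoint hω M x)) = 0 := by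
    rw [← sympAdjoint_apply_left hω, hω.alt.self_eq_zero]
  have h2 : ω x (M x) + ω x (sympAdjoint hω M x) = 0 := by
    rw [apply_sympAdjoint, ← hω.alt.neg_eq (M x), neg_add_cancel]
  rw [charForm_apply, h1, h2, hω.alt.self_eq_zero]
  simp

theorem charMatrix_eq {ω : LinearMap.BilinForm k V} (hω : IsSymplectic ω) (M : End k V)
    (s t : R) (b : Basis (Fin n ⊕ Fin n) k V) : charMatrix R hω b M s t =
      Matrix.of fun i j => charForm hω M s t (interleave b i) (interleave b j) := by
  ext i j
  simp only [charMatrix, Matrix.of_apply, charForm_apply, charEnd]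
  simp [Algebra.smul_def, LinearMap.BilinForm.baseChange_tmul]
  ring

/-- The symplectic characteristic polynomial, read off from a symplectic basis of common
eigenvectors of `M` and its adjoint. -/
theorem sympCharPoly_eq_prod {ω : LinearMap.BilinForm k V} (hω : IsSymplectic ω)
    (hn : finrank k V = 2 * n) (M : End k V) {b : Basis (Fin n ⊕ Fin n) k V}
    (hb : IsSymplecticBasis ω b) {lam mu : Fin n → k}
    (hl : ∀ i, M (b (Sum.inl i)) = lam i • b (Sum.inl i))
    (hl' : ∀ i, sympAdjoint hω M (b (Sum.inl i)) = mu i • b (Sum.inl i))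
    (hr : ∀ i, M (b (Sum.inr i)) = mu i • b (Sum.inr i))
    (hr' : ∀ i, sympAdjoint hω M (b (Sum.inr i)) = lam i • b (Sum.inr i)) :
    sympCharPoly hω hn M =
      ∏ i, ((Polynomial.C (Polynomial.C (lam i)) - Polynomial.C Polynomial.X) *
          (Polynomial.C (Polynomial.C (mu i)) - Polynomial.C Polynomial.X) - Polynomial.X) := by
  rw [sympCharPoly, charMatrix_eq]
  refine (pfaffianAlternating_eq_of_isSymplecticBasis hω hb
    (exists_isSymplecticBasis hω hn).choose_spec (charForm_isAlt hω M _ _)).trans ?_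
  have halg : ∀ c : k, algebraMap k k[X][Y] c = Polynomial.C (Polynomial.C c) := fun _ => rfl
  refine pfaffian_gram_of_eigen hω hb _ _ (fun x i => ?_) (fun x i => ?_)
  · simp only [charForm_apply, hl, hl', map_smul, smul_eq_mul, halg, map_add, map_mul]
    ring
  · simp only [charForm_apply, hr, hr', map_smul, smul_eq_mul, halg, map_add, map_mul]
    ring

end CharForm

/-! ### Symplectic bases of common eigenvectors -/

section Eigenbasis

variable {k V : Type*} [Field k] [AddCommGroup V] [Module k V]

theorem iSup_eigenspace_eq_top {ι : Type*} (b : Basis ι k V) {M : End k V}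
    (hb : ∀ i, ∃ c : k, M (b i) = c • b i) : ⨆ c, M.eigenspace c = ⊤ := by
  rw [eq_top_iff, ← b.span_eq, Submodule.span_le]
  rintro _ ⟨i, rfl⟩
  obtain ⟨c, hc⟩ := hb i
  exact Submodule.mem_iSup_of_mem c (End.mem_eigenspace_iff.2 hc)

theorem exists_common_eigenvector {W : Type*} [AddCommGroup W] [Module k W] {M N : End k V}
    (htop : ⨆ c, ⨆ d, M.eigenspace c ⊓ N.eigenspace d = ⊤) {φ : V →ₗ[k] W} (hφ : φ ≠ 0) :
    ∃ (v : V) (c d : k), M v = c • v ∧ N v = d • v ∧ φ v ≠ 0 := by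
  by_contra! h
  refine hφ (LinearMap.ker_eq_top.1 (eq_top_iff.2 (htop ▸ iSup₂_le fun c d v hv => ?_)))
  obtain ⟨h1, h2⟩ := Submodule.mem_inf.1 hv
  exact h v c d (End.mem_eigenspace_iff.1 h1) (End.mem_eigenspace_iff.1 h2)

variable [FiniteDimensional k V]

/-- The basis dual to a basis of eigenvectors of `M`, moved to `V` by `ω`, consists of
eigenvectors of the adjoint. -/
theorem iSup_eigenspace_sympAdjoint_eq_top {ω : LinearMap.BilinForm k V} (hω : IsSymplectic ω)
    {M : End k V} (hM : IsDiagonalizable M) : ⨆ c, (sympAdjoint hω M).eigenspace c = ⊤ := by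
  obtain ⟨b, hb⟩ := hM
  refine iSup_eigenspace_eq_top (b.dualBasis.map (flat hω).symm) fun i => ?_
  obtain ⟨c, hc⟩ := hb i
  refine ⟨c, ?_⟩
  have h : M.dualMap (b.coord i) = c • b.coord i := by
    refine b.ext fun j => ?_
    obtain ⟨d, hd⟩ := hb j
    by_cases hij : j = i
    · subst hij
      simp [hc]
    · simp [hd, Finsupp.single_eq_of_ne' hij]
  simp [sympAdjoint, h]

/-- Commuting endomorphisms whose eigenvectors span have spanning common eigenvectors. -/
theorem iSup_inf_eigenspace_eq_top {M N : End k V} (hMN : M * N = N * M)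
    (hM : ⨆ c, M.eigenspace c = ⊤) (hN : ⨆ c, N.eigenspace c = ⊤) :
    ⨆ c, ⨆ d, M.eigenspace c ⊓ N.eigenspace d = ⊤ := by
  rw [← hM]
  refine iSup_congr fun c => ?_
  have h := Submodule.inf_iSup_genEigenspace (p := M.eigenspace c) (f := N) (fun x hx => by
    rw [End.mem_eigenspace_iff] at hx ⊢
    rw [← Module.End.mul_apply, hMN, Module.End.mul_apply, hx, map_smul]) 1
  change M.eigenspace c ⊓ ⨆ d, N.eigenspace d = ⨆ d, M.eigenspace c ⊓ N.eigenspace d at h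
  rw [← h, hN, inf_top_eq]

/-- If common eigenvectors of `M` and its adjoint span `V`, symplectic vectors can be chosen
among them. Projecting to the orthogonal complement of the vectors already found commutes with
`M` and its adjoint, and a common eigenvector for eigenvalues `(c, d)` is orthogonal to all
those not belonging to `(d, c)`. -/
theorem exists_symplectic_eigenvectors {ω : LinearMap.BilinForm k V} (hω : IsSymplectic ω)
    {M : End k V}
    (htop : ⨆ c, ⨆ d, M.eigenspace c ⊓ (sympAdjoint hω M).eigenspace d = ⊤) {n : ℕ}
    (hd : finrank k V = 2 * n) : ∀ m : ℕ, m ≤ n → ∃ (e f : Fin m → V) (lam mu : Fin m → k),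
      ((∀ i j, ω (e i) (e j) = 0) ∧ (∀ i j, ω (f i) (f j) = 0) ∧
        ∀ i j, ω (e i) (f j) = if i = j then 1 else 0) ∧
      ∀ i, (M (e i) = lam i • e i ∧ sympAdjoint hω M (e i) = mu i • e i) ∧
        M (f i) = mu i • f i ∧ sympAdjoint hω M (f i) = lam i • f i := by
  intro m
  induction m with
  | zero => exact fun _ => ⟨Fin.elim0, Fin.elim0, Fin.elim0, Fin.elim0,
      ⟨fun i => i.elim0, fun i => i.elim0, fun i => i.elim0⟩, fun i => i.elim0⟩
  | succ m ih =>
    intro hm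
    obtain ⟨e, f, lam, mu, ⟨hee, hff, hef⟩, heig⟩ := ih (by omega)
    set N := sympAdjoint hω M with hN
    have hMN : ∀ v w, ω (M v) w = ω v (N w) := fun v w => (apply_sympAdjoint hω M v w).symm
    have hNM : ∀ v w, ω (N v) w = ω v (M w) := sympAdjoint_apply_left hω M
    have hsw : ∀ x y, ω x y = 0 → ω y x = 0 := fun x y h => hω.alt.isRefl x y h
    have hfe : ∀ i j, ω (f i) (e j) = if i = j then -1 else 0 := by
      intro i j
      rw [← hω.alt.neg_eq, hef]
      simp only [eq_comm (a := j)]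
      split_ifs <;> simp
    -- the projection to the orthogonal complement of the vectors found so far
    let P : V →ₗ[k] V := LinearMap.id - ∑ i, (ω.flip (f i)).smulRight (e i) +
      ∑ i, (ω.flip (e i)).smulRight (f i)
    have hP : ∀ v, P v = v - ∑ i, (ω v (f i)) • e i + ∑ i, (ω v (e i)) • f i := by
      intro v
      simp [P, LinearMap.sum_apply]
    have hPe : ∀ v j, ω (P v) (e j) = 0 := by
      intro v j
      simp [hP, hee, hfe]
    have hPf : ∀ v j, ω (P v) (f j) = 0 := by
      intro v j
      simp [hP, hff, hef]
    have hPM : ∀ v, M (P v) = P (M v) := by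
      intro v
      simp only [hP, map_add, map_sub, map_sum, map_smul, (heig _).1.1, (heig _).2.1, hMN,
        (heig _).1.2, (heig _).2.2, smul_smul, smul_eq_mul, mul_comm]
    have hPN : ∀ v, N (P v) = P (N v) := by
      intro v
      simp only [hP, map_add, map_sub, map_sum, map_smul, (heig _).1.1, (heig _).2.1, hNM,
        (heig _).1.2, (heig _).2.2, smul_smul, smul_eq_mul, mul_comm]
    have hP0 : P ≠ 0 := by
      intro h
      have hspan : Submodule.span k (Set.range (Sum.elim e f)) = ⊤ := by
        rw [eq_top_iff]
        intro v _
        have hv : v = ∑ i, (ω v (f i)) • e i - ∑ i, (ω v (e i)) • f i := by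
          have := hP v
          rw [h, LinearMap.zero_apply] at this
          rw [← sub_eq_zero, this]
          abel
        rw [hv]
        refine Submodule.sub_mem _ (Submodule.sum_mem _ fun i _ => ?_)
          (Submodule.sum_mem _ fun i _ => ?_)
        · exact Submodule.smul_mem _ _ (Submodule.subset_span ⟨Sum.inl i, rfl⟩)
        · exact Submodule.smul_mem _ _ (Submodule.subset_span ⟨Sum.inr i, rfl⟩)
      have h1 := finrank_range_le_card (R := k) (Sum.elim e f)
      rw [Set.finrank, hspan, finrank_top, hd] at h1
      simp at h1
      omega
    obtain ⟨v, c, d, hvc, hvd, hv⟩ := exists_common_eigenvector htop hP0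
    set x := P v with hx
    have hMx : M x = c • x := by rw [hx, hPM, hvc, map_smul]
    have hNx : N x = d • x := by rw [hx, hPN, hvd, map_smul]
    have hωx : ω x ≠ 0 := fun h => hv (hω.nondegenerate.1 _ fun w => by rw [h]; rfl)
    obtain ⟨w, c', d', hwc, hwd, hw⟩ := exists_common_eigenvector htop hωx
    -- the eigenvalues of `w` are those of `x` exchanged, as `w` is not orthogonal to `x`
    have hc' : c' = d := by
      have h := hNM x w
      rw [hNx, hwc, map_smul, map_smul, LinearMap.smul_apply, smul_eq_mul, smul_eq_mul] at h
      exact (mul_right_cancel₀ hw h).symm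
    have hd' : d' = c := by
      have h := hMN x w
      rw [hMx, hwd, map_smul, map_smul, LinearMap.smul_apply, smul_eq_mul, smul_eq_mul] at h
      exact (mul_right_cancel₀ hw h).symm
    subst hc' hd'
    have hxe : ∀ j, ω x (e j) = 0 := hPe v
    have hxf : ∀ j, ω x (f j) = 0 := hPf v
    set y := (ω x w)⁻¹ • P w with hy
    have hye : ∀ j, ω y (e j) = 0 := by intro j; simp [hy, hPe]
    have hyf : ∀ j, ω y (f j) = 0 := by intro j; simp [hy, hPf]
    have hxy : ω x y = 1 := by
      simp [hy, hP, hxe, hxf, hw]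
    have hMy : M y = c' • y := by rw [hy, map_smul, hPM, hwc, map_smul, smul_comm]
    have hNy : N y = d' • y := by rw [hy, map_smul, hPN, hwd, map_smul, smul_comm]
    refine ⟨Fin.cons x e, Fin.cons y f, Fin.cons d' lam, Fin.cons c' mu, ⟨?_, ?_, ?_⟩, ?_⟩
    · intro i j
      refine Fin.cases ?_ (fun i => ?_) i <;> refine Fin.cases ?_ (fun j => ?_) j
      · simpa using hω.alt x
      · simpa using hxe j
      · simpa using hsw _ _ (hxe i)
      · simpa using hee i j
    · intro i j
      refine Fin.cases ?_ (fun i => ?_) i <;> refine Fin.cases ?_ (fun j => ?_) j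
      · simpa using hω.alt y
      · simpa using hyf j
      · simpa using hsw _ _ (hyf i)
      · simpa using hff i j
    · intro i j
      refine Fin.cases ?_ (fun i => ?_) i <;> refine Fin.cases ?_ (fun j => ?_) j
      · simpa using hxy
      · simpa [(Fin.succ_ne_zero j).symm] using hxf j
      · simpa [Fin.succ_ne_zero] using hsw _ _ (hye i)
      · simpa using hef i j
    · intro i
      refine Fin.cases ?_ (fun i => ?_) i
      · exact ⟨⟨hMx, hNx⟩, hMy, hNy⟩
      · exact heig i

theorem exists_isSymplecticBasis_of_vectors {ω : LinearMap.BilinForm k V} {n : ℕ}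
    (hn : finrank k V = 2 * n) {e f : Fin n → V} (hee : ∀ i j, ω (e i) (e j) = 0)
    (hff : ∀ i j, ω (f i) (f j) = 0) (hef : ∀ i j, ω (e i) (f j) = if i = j then 1 else 0) :
    ∃ b : Basis (Fin n ⊕ Fin n) k V, IsSymplecticBasis ω b ∧ ⇑b = Sum.elim e f := by
  have hli : LinearIndependent k (Sum.elim e f) := by
    rw [Fintype.linearIndependent_iff]
    intro g hg
    have h1 : ∑ i, g (Sum.inl i) • e i + ∑ i, g (Sum.inr i) • f i = 0 := by
      simpa [Fintype.sum_sum_type] using hg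
    rintro (j | j)
    · have := congrArg (fun z => ω z (f j)) h1
      simpa [hff, hef] using this
    · have := congrArg (fun z => ω (e j) z) h1
      simpa [hee, hef] using this
  let b := basisOfLinearIndependentOfCardEqFinrank' (Sum.elim e f) hli (by simp [hn]; omega)
  have hb : ⇑b = Sum.elim e f := coe_basisOfLinearIndependentOfCardEqFinrank' _ _ _
  exact ⟨b, ⟨by simpa [hb] using hee, by simpa [hb] using hff, by simpa [hb] using hef⟩, hb⟩

end Eigenbasis

/-! ### Uniqueness of the factorisation -/

section Factorisation

variable {k : Type*} [Field k]

theorem exists_perm_of_multiset_map_eq {ι α : Type*} [Fintype ι] {f g : ι → α}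
    (h : Finset.univ.val.map f = Finset.univ.val.map g) :
    ∃ π : Equiv.Perm ι, ∀ i, g (π i) = f i := by
  classical
  have hcard : ∀ c, Nonempty ({i // f i = c} ≃ {i // g i = c}) := by
    intro c
    have h1 := congrArg (Multiset.count c) h
    rw [Multiset.count_map, Multiset.count_map] at h1
    refine ⟨Fintype.equivOfCardEq ?_⟩
    rw [Fintype.card_subtype, Fintype.card_subtype]
    simp only [eq_comm (b := c)]
    exact h1
  exact ⟨Equiv.ofFiberEquiv fun c => (hcard c).some, fun i => Equiv.ofFiberEquiv_map _ i⟩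

theorem exists_perm_of_prod_C_sub_X_eq {ι D : Type*} [Fintype ι] [CommRing D] [IsDomain D]
    {p q : ι → D} (h : ∏ i, (Polynomial.C (p i) - Polynomial.X) =
      ∏ i, (Polynomial.C (q i) - Polynomial.X)) : ∃ π : Equiv.Perm ι, ∀ i, q (π i) = p i := by
  have key : ∀ r : ι → D, ∏ i, (Polynomial.C (r i) - Polynomial.X) = (-1) ^ Fintype.card ι *
      ((Finset.univ.val.map r).map fun a => Polynomial.X - Polynomial.C a).prod := by
    intro r
    rw [Multiset.map_map]
    change _ = _ * ∏ i, (Polynomial.X - Polynomial.C (r i))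
    rw [← Finset.card_univ, ← Finset.prod_const, ← Finset.prod_mul_distrib]
    exact Finset.prod_congr rfl fun i _ => by ring
  rw [key, key] at h
  have h1 := congrArg Polynomial.roots
    (mul_left_cancel₀ (pow_ne_zero _ (neg_ne_zero.2 one_ne_zero)) h)
  rw [Polynomial.roots_multiset_prod_X_sub_C, Polynomial.roots_multiset_prod_X_sub_C] at h1
  exact exists_perm_of_multiset_map_eq h1

theorem eq_or_eq_swap_of_mul_eq {a b c d : k}
    (h : (Polynomial.C a - Polynomial.X) * (Polynomial.C b - Polynomial.X) =
      (Polynomial.C c - Polynomial.X) * (Polynomial.C d - Polynomial.X)) :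
    (a = c ∧ b = d) ∨ (a = d ∧ b = c) := by
  have h1 := congrArg (Polynomial.eval a) h
  simp only [Polynomial.eval_mul, Polynomial.eval_sub, Polynomial.eval_C, Polynomial.eval_X,
    sub_self, zero_mul] at h1
  have h3 : a + b = c + d := by
    have h2 := congrArg (fun p : k[X] => p.coeff 1) h
    simp [Polynomial.mul_coeff_one] at h2
    linear_combination -h2
  rcases mul_eq_zero.1 h1.symm with h | h
  · rw [sub_eq_zero] at h
    exact Or.inl ⟨h.symm, by rw [h] at h3; exact add_left_cancel h3⟩
  · rw [sub_eq_zero] at h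
    exact Or.inr ⟨h.symm, by rw [h, add_comm c] at h3; exact add_left_cancel h3⟩

end Factorisation

end SymplecticLA

/-! ### Symplectic bases adapted to given eigenvalues -/

theorem mainTheorem1 {k : Type*} [Field k] {V : Type*} [AddCommGroup V] [Module k V]
    [FiniteDimensional k V] (ω : LinearMap.BilinForm k V) (hω : IsSymplectic ω)
    (n : ℕ) (hn : Module.finrank k V = 2 * n) (M : Module.End k V)
    (hnormal : M * sympAdjoint hω M = sympAdjoint hω M * M)
    (hdiag : IsDiagonalizable M) :
    (∃ lam mu : Fin n → k,
      sympCharPoly hω hn M =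
        ∏ i, ((Polynomial.C (Polynomial.C (lam i)) - Polynomial.C Polynomial.X) *
          (Polynomial.C (Polynomial.C (mu i)) - Polynomial.C Polynomial.X) - Polynomial.X)) ∧
    ∀ lam mu : Fin n → k,
      sympCharPoly hω hn M =
        ∏ i, ((Polynomial.C (Polynomial.C (lam i)) - Polynomial.C Polynomial.X) *
          (Polynomial.C (Polynomial.C (mu i)) - Polynomial.C Polynomial.X) - Polynomial.X) →
      ∃ b : Module.Basis (Fin n ⊕ Fin n) k V, IsSymplecticBasis ω b ∧
        ∀ i, M (b (Sum.inl i)) = lam i • b (Sum.inl i) ∧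
          M (b (Sum.inr i)) = mu i • b (Sum.inr i) := by
  have htop := iSup_inf_eigenspace_eq_top hnormal
    (iSup_eigenspace_eq_top hdiag.choose hdiag.choose_spec)
    (iSup_eigenspace_sympAdjoint_eq_top hω hdiag)
  obtain ⟨e, f, lam₀, mu₀, ⟨hee, hff, hef⟩, heig⟩ :=
    exists_symplectic_eigenvectors hω htop hn n le_rfl
  obtain ⟨b, hb, hbe⟩ := exists_isSymplecticBasis_of_vectors hn hee hff hef
  have hχ := sympCharPoly_eq_prod hω hn M hb (lam := lam₀) (mu := mu₀)
    (fun i => by simpa [hbe] using (heig i).1.1) (fun i => by simpa [hbe] using (heig i).1.2)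
    (fun i => by simpa [hbe] using (heig i).2.1) (fun i => by simpa [hbe] using (heig i).2.2)
  refine ⟨⟨lam₀, mu₀, hχ⟩, fun lam mu h => ?_⟩
  rw [hχ] at h
  simp only [← Polynomial.C_sub, ← Polynomial.C_mul] at h
  obtain ⟨π, hπ⟩ := exists_perm_of_prod_C_sub_X_eq h.symm
  have hor := fun i => eq_or_eq_swap_of_mul_eq (hπ i)
  classical
  -- where the eigenvalues of a pair come in the other order, `(e, f)` is replaced by `(f, -e)`
  let s : Fin n → Prop := fun i => lam₀ (π i) = lam i ∧ mu₀ (π i) = mu i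
  let e' : Fin n → V := fun i => if s i then e (π i) else f (π i)
  let f' : Fin n → V := fun i => if s i then f (π i) else -e (π i)
  have hfe : ∀ i j, ω (f i) (e j) = if i = j then -1 else 0 := by
    simpa [hbe] using hb.right_left hω
  have hne : ∀ i j, s i → ¬ s j → i ≠ j := fun i j hi hj hij => hj (hij ▸ hi)
  obtain ⟨b', hb', hbe'⟩ := exists_isSymplecticBasis_of_vectors (ω := ω) hn (e := e') (f := f')
    (fun i j => by
      by_cases hi : s i <;> by_cases hj : s j
      · simp [e', hi, hj, hee]
      · simp [e', hi, hj, hef, hne i j hi hj]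
      · simp [e', hi, hj, hfe, (hne j i hj hi).symm]
      · simp [e', hi, hj, hff])
    (fun i j => by
      by_cases hi : s i <;> by_cases hj : s j
      · simp [f', hi, hj, hff]
      · simp [f', hi, hj, hfe, hne i j hi hj]
      · simp [f', hi, hj, hef, (hne j i hj hi).symm]
      · simp [f', hi, hj, hee])
    (fun i j => by
      by_cases hi : s i <;> by_cases hj : s j
      · simp [e', f', hi, hj, hef]
      · simp [e', f', hi, hj, hee, hne i j hi hj]
      · simp [e', f', hi, hj, hff, (hne j i hj hi).symm]
      · simp only [e', f', hi, hj, if_false, map_neg, hfe, π.injective.eq_iff]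
        split_ifs <;> simp)
  refine ⟨b', hb', fun i => ?_⟩
  rw [hbe', Sum.elim_inl, Sum.elim_inr]
  by_cases hi : s i
  · simp only [e', f', hi, if_true]
    rw [(heig _).1.1, (heig _).2.1, hi.1, hi.2]
    exact ⟨rfl, rfl⟩
  · obtain ⟨h1, h2⟩ := (hor i).resolve_left hi
    simp only [e', f', hi, if_false, map_neg, smul_neg]
    rw [(heig _).1.1, (heig _).2.1, h1, h2]
    exact ⟨rfl, rfl⟩
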